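/- Let $n\ge 0$. A sequence $(a_1,\dots,a_n)$ with $a_i\in\{1,\dots,n\}$ is called a parking function of length $n$ if its weakly increasing rearrangement $b_1\le b_2\le\dots\le b_n$ satisfies $b_i\le i$ for all $i\in\{1,\dots,n\}$. Let $\mathcal P_n\subset\mathbb R^n$ be the convex hull of all parking functions of length $n$. A face of $\mathcal P_n$ is a set of the form $\mathcal P_n\cap\{x : c\cdot x=d\}$, where $c\in\mathbb R^n$ and $d\in\mathbb R$ are such that $c\cdot x\le d$ for all $x\in\mathcal P_n$ (so $\mathcal P_n$ itself is a face); the dimension of a nonempty face is the dimension of its affine span, and the empty face is not counted in any dimension $\ge 0$. For $0\le s\le n$ with $(n,s)\ne(1,0)$, the number $f_{n-s}$ of $(n-s)$-dimensional faces of $\mathcal P_n$ is finite and equals $$f_{n-s}=\sum_{\substack{0\le m\le s\\ m\ne 1}}\binom{n}{m}\,(s-m)!\,S(n-m+1,\,s-m+1),$$ where $S(a,b)$ is the Stirling number of the second kind, i.e. the number of partitions of an $a$-element set into $b$ nonempty blocks. -/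

import Mathlib

namespace ParkingPolytope

/-- A sequence `a` of `n` integers in `{1, …, n}` is a parking function if its weakly increasing
rearrangement `b = a ∘ Tuple.sort a` satisfies `b i ≤ i` for all `i`
(positions are counted from `0` in `Fin n`, hence the shift by one). -/
def IsParkingFunction {n : ℕ} (a : Fin n → ℕ) : Prop :=
  (∀ i, 1 ≤ a i ∧ a i ≤ n) ∧ ∀ i : Fin n, a (Tuple.sort a i) ≤ (i : ℕ) + 1

/-- The polytope `P_n`: the convex hull in `ℝⁿ` of all parking functions of length `n`. -/
def parkingPolytope (n : ℕ) : Set (Fin n → ℝ) :=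
  convexHull ℝ {x | ∃ a : Fin n → ℕ, IsParkingFunction a ∧ ∀ i, x i = (a i : ℝ)}

/-- `F` is a face of `P`: the intersection of `P` with a hyperplane-type set `{x | c ⬝ᵥ x = d}`
such that `c ⬝ᵥ x ≤ d` holds on all of `P`. In particular `P` itself (`c = 0`, `d = 0`) and the
empty set (`c = 0`, `d = 1`) are faces. -/
def IsFace {n : ℕ} (P F : Set (Fin n → ℝ)) : Prop :=
  ∃ (c : Fin n → ℝ) (d : ℝ), (∀ x ∈ P, c ⬝ᵥ x ≤ d) ∧ F = P ∩ {x | c ⬝ᵥ x = d}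

/-- The set of `k`-dimensional faces of `P`, for `k ≥ 0`. The dimension of a nonempty face is the
dimension of its affine span; the empty face (of dimension `-1`) is excluded. -/
def facesOfDim {n : ℕ} (P : Set (Fin n → ℝ)) (k : ℕ) : Set (Set (Fin n → ℝ)) :=
  {F | IsFace P F ∧ F.Nonempty ∧ Module.finrank ℝ (affineSpan ℝ F).direction = k}

end ParkingPolytope

/-!
The parking polytope satisfies `1 ≤ x i` and `∑ i ∈ U, x i ≤ n + (n - 1) + ⋯ + (n - #U + 1)` for
every set `U` of coordinates, since parking functions are the positive integer sequences lying
below a permutation of `1, …, n` (`isParkingFunction_iff`). A functional `c` is a combination of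
indicators of its superlevel sets at positive levels, minus its negative part, and a greedy parking
function makes all the corresponding inequalities tight at once. Hence the face where `c` is
maximal is cut out by tightness of these inequalities (`dotProduct_le_of_mem_tightFace`), and it
depends only on the negative coordinates of `c` and on the order of its positive coordinates. This
is recorded by a level function `t : Fin n → ℕ`: level `0` means negative, level `1` means zero, and
the levels `≥ 2` rank the positive values without gaps.

Swapping two values of a vertex within a block of equal level, or lowering a value of level `1` to
`1`, stays in the face; this determines the direction of its affine span, whose codimension is the
number of zeros of `t` plus the number of levels `≥ 2` (`finrank_levelFace`). The one degeneracy is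
that a single coordinate of level at most `1` is forced to be `1`, and can then as well be made the
lowest block (`exists_nondegenerate`). Apart from this the face determines `t`, because the tight
sets of the face are exactly the superlevel sets of `t` (`tight_iff`, `levelFace_injective`).

It remains to count the gap-free `t` of given codimension with `#{i | t i ≤ 1} ≠ 1`. Raising all
levels by one when there is exactly one zero shows that they are equinumerous with the `t` having
`#{i | t i = 0} ≠ 1` (`ncard_nondegenerate`), which is where the summand `m = 1` disappears. With
`m` zeros and `r` levels `≥ 2` there are `n.choose m * r! * S(n - m + 1, r + 1)` gap-free level
functions (`ncard_gapFree`): the extra element marks the possibly empty block of level `1`.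
-/

namespace ParkingPolytope
open Finset

/-! ### Level functions with prescribed zeros and values -/

/-- Level functions with prescribed number `m` of zeros and prescribed set `B` of nonzero values:
choose the zeros, then map the other positions onto `B`. -/
lemma card_levels {α : Type*} [Fintype α] [DecidableEq α] (z : α) (n m : ℕ) (B : Finset α)
    (hB : z ∉ B) :
    #{t : Fin n → α | #{i | t i = z} = m ∧ (univ.image t).erase z = B} =
      n.choose m * (#B).factorial * Nat.stirlingSecond (n - m) #B := by
  induction n generalizing m B with
  | zero =>
    rcases m with _ | m
    · rcases B.eq_empty_or_nonempty with rfl | hne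
      · simp
      · have h1 : ¬ (∅ : Finset α) = B := fun h => by simp [← h] at hne
        have : #B ≠ 0 := hne.card_ne_zero
        obtain ⟨k, hk⟩ := Nat.exists_eq_succ_of_ne_zero this
        simp [h1, hk]
    · simp
  | succ n ih =>
    -- split a level function into its first value `v` and its remaining values
    have hsplit : #{t : Fin (n + 1) → α | #{i | t i = z} = m ∧ (univ.image t).erase z = B} =
        ∑ v : α, #{t : Fin n → α | #{i | (Fin.cons v t : Fin (n + 1) → α) i = z} = m ∧
          (univ.image (Fin.cons v t : Fin (n + 1) → α)).erase z = B} := by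
      simp only [card_filter]
      rw [← (Fin.consEquiv (fun _ : Fin (n + 1) => α)).sum_comp, Fintype.sum_prod_type]
      rfl
    have hz : ∀ (v : α) (t : Fin n → α), #{i | (Fin.cons v t : Fin (n + 1) → α) i = z} =
        (if v = z then 1 else 0) + #{i | t i = z} := by
      intro v t
      rw [Fin.card_filter_univ_succ]
      simp only [Fin.cons_zero, Fin.cons_succ]
      split_ifs <;> simp [add_comm]
    have himg : ∀ (v : α) (t : Fin n → α), univ.image (Fin.cons v t : Fin (n + 1) → α) =
        insert v (univ.image t) := by
      intro v t
      ext w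
      simp [Fin.exists_fin_succ, eq_comm]
    have hv : ∀ v ∈ B, #{t : Fin n → α | #{i | (Fin.cons v t : Fin (n + 1) → α) i = z} = m ∧
          (univ.image (Fin.cons v t : Fin (n + 1) → α)).erase z = B} =
        n.choose m * (#B).factorial * Nat.stirlingSecond (n - m) #B +
        n.choose m * (#B - 1).factorial * Nat.stirlingSecond (n - m) (#B - 1) := by
      intro v hvB
      have hvz : v ≠ z := fun h => hB (h ▸ hvB)
      rw [← ih m B hB, ← card_erase_of_mem hvB,
        ← ih m (B.erase v) (fun h => hB (mem_of_mem_erase h)), ← card_union_of_disjoint]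
      · congr 1
        ext t
        simp only [mem_filter, mem_univ, true_and, mem_union, hz, himg, hvz, if_false, zero_add,
          ← and_or_left]
        refine and_congr_right fun _ => ?_
        rw [erase_insert_of_ne hvz]
        constructor
        · intro h
          by_cases hm : v ∈ (univ.image t).erase z
          · left; rwa [insert_eq_of_mem hm] at h
          · right; rw [← h, erase_insert hm]
        · rintro (h | h)
          · rw [h, insert_eq_of_mem hvB]
          · rw [h, insert_erase hvB]
      · rw [disjoint_filter]
        rintro t - ⟨-, h1⟩ ⟨-, h2⟩
        rw [h1] at h2
        exact (notMem_erase v B) (h2 ▸ hvB)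
    have hother : ∀ v, v ∉ insert z B →
        #{t : Fin n → α | #{i | (Fin.cons v t : Fin (n + 1) → α) i = z} = m ∧
          (univ.image (Fin.cons v t : Fin (n + 1) → α)).erase z = B} = 0 := by
      intro v hv
      rw [card_eq_zero, filter_eq_empty_iff]
      rintro t - ⟨-, h2⟩
      rw [mem_insert, not_or] at hv
      apply hv.2
      rw [← h2, himg]
      simp [hv.1]
    have hvz : #{t : Fin n → α | #{i | (Fin.cons z t : Fin (n + 1) → α) i = z} = m ∧
          (univ.image (Fin.cons z t : Fin (n + 1) → α)).erase z = B} =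
        #{t : Fin n → α | 1 + #{i | t i = z} = m ∧ (univ.image t).erase z = B} := by
      congr 1
      ext t
      simp only [mem_filter, mem_univ, true_and, hz, himg, if_true]
      rw [show (insert z (univ.image t)).erase z = (univ.image t).erase z by ext w; simp +contextual]
    rw [hsplit, ← sum_subset (subset_univ (insert z B)) (fun v _ hv => hother v hv),
      sum_insert hB, sum_congr rfl hv, hvz, sum_const, smul_eq_mul]
    -- `b * (b! S(k, b) + (b - 1)! S(k, b - 1)) = b! S(k + 1, b)`
    have hstir : ∀ k : ℕ, #B * ((#B).factorial * Nat.stirlingSecond k #B +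
        (#B - 1).factorial * Nat.stirlingSecond k (#B - 1)) =
        (#B).factorial * Nat.stirlingSecond (k + 1) #B := by
      intro k
      rcases hb : #B with _ | b
      · simp
      · rw [Nat.stirlingSecond_succ_succ, Nat.add_sub_cancel, Nat.factorial_succ]
        ring
    have hrest : #B * (n.choose m * (#B).factorial * Nat.stirlingSecond (n - m) #B +
        n.choose m * (#B - 1).factorial * Nat.stirlingSecond (n - m) (#B - 1)) =
        n.choose m * ((#B).factorial * Nat.stirlingSecond (n + 1 - m) #B) := by
      rcases le_or_gt m n with h | h
      · rw [Nat.succ_sub h, ← hstir]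
        ring
      · simp [Nat.choose_eq_zero_of_lt h]
    rw [hrest]
    rcases m with _ | m
    · simp
    · have : #{t : Fin n → α | 1 + #{i | t i = z} = m + 1 ∧ (univ.image t).erase z = B} =
          n.choose m * (#B).factorial * Nat.stirlingSecond (n - m) #B := by
        rw [← ih m B hB]
        simp only [add_comm 1, add_left_inj]
      rw [this, Nat.choose_succ_succ]
      simp only [Nat.add_sub_add_right]
      ring

lemma ncard_levels (n m : ℕ) (B : Finset ℕ) (hB : 0 ∉ B) :
    {t : Fin n → ℕ | #{i | t i = 0} = m ∧ (univ.image t).erase 0 = B}.Finite ∧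
    {t : Fin n → ℕ | #{i | t i = 0} = m ∧ (univ.image t).erase 0 = B}.ncard =
      n.choose m * (#B).factorial * Nat.stirlingSecond (n - m) #B := by
  let K := B.sup id + 1
  have hK : ∀ b ∈ B, b < K := fun b hb => Nat.lt_succ_of_le (le_sup (f := id) hb)
  let B' : Finset (Fin K) := B.attachFin hK
  have hB' : (0 : Fin K) ∉ B' := by simpa [B', mem_attachFin] using hB
  have hinj : Function.Injective (fun (t : Fin n → Fin K) (i : Fin n) => (t i : ℕ)) :=
    fun t u h => funext fun i => Fin.ext (congrFun h i)
  have hset : {t : Fin n → ℕ | #{i | t i = 0} = m ∧ (univ.image t).erase 0 = B} =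
      (fun (t : Fin n → Fin K) (i : Fin n) => (t i : ℕ)) '' (({t : Fin n → Fin K |
        #{i | t i = 0} = m ∧ (univ.image t).erase 0 = B'} : Finset _) : Set (Fin n → Fin K)) := by
    have hiff : ∀ t : Fin n → Fin K,
        (#{i | (t i : ℕ) = 0} = m ∧ (univ.image (fun i => (t i : ℕ))).erase 0 = B) ↔
        (#{i | t i = 0} = m ∧ (univ.image t).erase 0 = B') := by
      intro t
      have h0 : ∀ i, (t i : ℕ) = 0 ↔ t i = 0 := fun i => by
        rw [Fin.ext_iff]; rfl
      simp only [h0]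
      refine and_congr_right fun _ => ?_
      simp only [Finset.ext_iff, mem_erase, mem_image, mem_univ, true_and]
      constructor
      · intro h w
        change _ ↔ w ∈ B.attachFin hK
        rw [mem_attachFin, ← h w]
        simp only [ne_eq, Fin.ext_iff]
        rfl
      · intro h w
        by_cases hw : w < K
        · have := h ⟨w, hw⟩
          simp only [B', mem_attachFin] at this
          rw [← this]
          simp only [ne_eq, Fin.ext_iff]
          rfl
        · constructor
          · rintro ⟨-, i, rfl⟩; exact absurd (t i).2 hw
          · intro h'; exact absurd (hK w h') hw
    ext t
    simp only [Set.mem_ofPred_eq, Set.mem_image, mem_coe, mem_filter, mem_univ, true_and]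
    constructor
    · rintro ⟨h1, h2⟩
      have hlt : ∀ i, t i < K := by
        intro i
        by_cases hi : t i = 0
        · rw [hi]; exact Nat.succ_pos _
        · refine hK _ ?_
          rw [← h2]
          exact mem_erase.2 ⟨hi, mem_image_of_mem t (mem_univ i)⟩
      exact ⟨fun i => ⟨t i, hlt i⟩, (hiff _).1 ⟨h1, h2⟩, rfl⟩
    · rintro ⟨u, hu, rfl⟩
      exact (hiff u).2 hu
  rw [hset]
  refine ⟨(finite_toSet _).image _, ?_⟩
  rw [Set.ncard_image_of_injective _ hinj, Set.ncard_coe_finset, card_levels _ _ _ _ hB',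
    card_attachFin]

variable {n : ℕ}

/-! ### Largest sums over sets of positions -/

/-- The top `k` positions of `Fin n`. -/
def topSet (n k : ℕ) : Finset (Fin n) := {i | n - k ≤ (i : ℕ)}

lemma mem_topSet {k : ℕ} {i : Fin n} : i ∈ topSet n k ↔ n - k ≤ (i : ℕ) := by
  simp [topSet]

/-- The sum of the `k` largest elements of `{1, …, n}`. -/
def topSum (n k : ℕ) : ℝ := ∑ i ∈ topSet n k, (((i : ℕ) : ℝ) + 1)

lemma card_topSet {k : ℕ} (hk : k ≤ n) : #(topSet n k) = k := by
  have h2 := Finset.card_filter_add_card_filter_not (s := (univ : Finset (Fin n)))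
    (fun i : Fin n => (i : ℕ) < n - k)
  simp only [not_lt, card_univ, Fintype.card_fin] at h2
  have h3 : #{i : Fin n | (i : ℕ) < n - k} = n - k := by
    rw [Fin.card_filter_val_lt, min_eq_right (Nat.sub_le n k)]
  rw [topSet]
  omega

lemma topSum_zero : topSum n 0 = 0 := by
  refine Finset.sum_eq_zero fun i hi => ?_
  have := mem_topSet.1 hi
  have := i.2
  omega

/-- Replacing a set of positions by the set of top positions of the same size increases the sum
by at least one for every position that has to be moved. -/
lemma sum_add_card_sdiff_le_topSum (S : Finset (Fin n)) :
    ∑ i ∈ S, (((i : ℕ) : ℝ) + 1) + #(S \ topSet n #S) ≤ topSum n #S := by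
  classical
  set T : Finset (Fin n) := topSet n #S with hT
  have hk : #S ≤ n := by simpa using card_le_univ S
  have hcard : #T = #S := card_topSet hk
  have hd : #(S \ T) = #(T \ S) := by
    have h1 := card_sdiff_add_card_inter S T
    have h2 := card_sdiff_add_card_inter T S
    rw [inter_comm] at h2
    omega
  have h1 : ∑ i ∈ S \ T, (((i : ℕ) : ℝ) + 1) ≤ #(S \ T) • ((n - #S : ℕ) : ℝ) := by
    refine sum_le_card_nsmul _ _ _ fun i hi => ?_
    have : ¬ n - #S ≤ (i : ℕ) := mem_topSet.not.1 (mem_sdiff.1 hi).2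
    have : (i : ℕ) + 1 ≤ n - #S := by omega
    exact_mod_cast this
  have h2 : #(T \ S) • (((n - #S : ℕ) : ℝ) + 1) ≤ ∑ i ∈ T \ S, (((i : ℕ) : ℝ) + 1) := by
    refine card_nsmul_le_sum _ _ _ fun i hi => ?_
    have : n - #S ≤ (i : ℕ) := mem_topSet.1 (mem_sdiff.1 hi).1
    have : ((n - #S : ℕ) : ℝ) ≤ ((i : ℕ) : ℝ) := by exact_mod_cast this
    linarith
  have h3 := (sum_inter_add_sum_sdiff S T (fun i : Fin n => ((i : ℕ) : ℝ) + 1))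
  have h4 := (sum_inter_add_sum_sdiff T S (fun i : Fin n => ((i : ℕ) : ℝ) + 1))
  rw [inter_comm] at h4
  have h5 : topSum n #S = ∑ i ∈ T, (((i : ℕ) : ℝ) + 1) := rfl
  rw [nsmul_eq_mul] at h1 h2
  rw [← hd] at h2
  rw [h5]
  linarith

lemma sum_eq_topSum_iff (S : Finset (Fin n)) :
    ∑ i ∈ S, (((i : ℕ) : ℝ) + 1) = topSum n #S ↔ ∀ i ∈ S, ∀ k ∉ S, k < i := by
  have hk : #S ≤ n := by simpa using card_le_univ S
  have hcard := card_topSet hk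
  constructor
  · intro h
    have h1 := sum_add_card_sdiff_le_topSum S
    rw [h] at h1
    have h2 : #(S \ topSet n #S) = 0 := by
      have : (#(S \ topSet n #S) : ℝ) ≤ 0 := by linarith
      exact Nat.le_zero.1 (by exact_mod_cast this)
    have h3 : S ⊆ topSet n #S := by
      rwa [card_eq_zero, sdiff_eq_empty_iff_subset] at h2
    have h4 := eq_of_subset_of_card_le h3 hcard.le
    intro i hi k hk'
    have hi' := h3 hi
    rw [h4] at hk'
    simp only [mem_topSet, not_le] at hi' hk'
    exact Fin.lt_def.2 (by omega)
  · intro h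
    have h3 : S ⊆ topSet n #S := by
      intro j hj
      have hsub : Ici j ⊆ S := by
        intro l hl
        by_contra hlS
        exact absurd (h j hj l hlS) (not_lt.2 (mem_Ici.1 hl))
      have := card_le_card hsub
      rw [Fin.card_Ici] at this
      rw [mem_topSet]
      omega
    have h4 := eq_of_subset_of_card_le h3 hcard.le
    rw [topSum, ← h4]

lemma perm_sum_le_topSum (π : Equiv.Perm (Fin n)) (U : Finset (Fin n)) :
    ∑ i ∈ U, (((π i : ℕ) : ℝ) + 1) ≤ topSum n #U := by
  have h := sum_add_card_sdiff_le_topSum (U.map π.toEmbedding)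
  rw [sum_map, card_map] at h
  refine le_trans ?_ h
  simp

lemma perm_sum_eq_topSum_iff (π : Equiv.Perm (Fin n)) (U : Finset (Fin n)) :
    ∑ i ∈ U, (((π i : ℕ) : ℝ) + 1) = topSum n #U ↔ ∀ i ∈ U, ∀ k ∉ U, π k < π i := by
  have h := sum_eq_topSum_iff (U.map π.toEmbedding)
  rw [sum_map, card_map] at h
  refine Iff.trans h ⟨fun h i hi k hk => ?_, fun h i hi k hk => ?_⟩
  · exact h _ (by simpa using hi) _ (by simpa using hk)
  · obtain ⟨i, rfl⟩ := π.surjective i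
    obtain ⟨k, rfl⟩ := π.surjective k
    exact h _ (by simpa using hi) _ (by simpa using hk)

/-! ### Parking functions and the inequalities of the polytope -/

/-- Parking functions are the positive sequences lying below a permutation of `1, …, n`. -/
lemma isParkingFunction_iff {a : Fin n → ℕ} :
    IsParkingFunction a ↔ ∃ π : Equiv.Perm (Fin n), ∀ i, 1 ≤ a i ∧ a i ≤ (π i : ℕ) + 1 := by
  constructor
  · rintro ⟨h1, h2⟩
    refine ⟨(Tuple.sort a)⁻¹, fun i => ⟨(h1 i).1, ?_⟩⟩
    simpa using h2 ((Tuple.sort a)⁻¹ i)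
  · rintro ⟨π, h⟩
    refine ⟨fun i => ⟨(h i).1, (h i).2.trans (π i).2⟩, fun i => ?_⟩
    by_contra! hlt
    -- the `n - i` positions `≥ i` of the sorted sequence all need `π`-values above `i`
    have hsub : (Ici i).map ((Tuple.sort a).trans π).toEmbedding ⊆ Ioi i := by
      intro j hj
      simp only [mem_map, mem_Ici, Equiv.coe_toEmbedding, Equiv.trans_apply] at hj
      obtain ⟨l, hl, rfl⟩ := hj
      have h3 : a (Tuple.sort a i) ≤ a (Tuple.sort a l) := Tuple.monotone_sort a hl
      have h4 := (h (Tuple.sort a l)).2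
      rw [mem_Ioi, Fin.lt_def]
      omega
    have := card_le_card hsub
    rw [card_map, Fin.card_Ici, Fin.card_Ioi] at this
    have := i.2
    omega

/-- The points of `ℝⁿ` that are parking functions. -/
def parkingPoints (n : ℕ) : Set (Fin n → ℝ) :=
  {x | ∃ a : Fin n → ℕ, IsParkingFunction a ∧ ∀ i, x i = (a i : ℝ)}

lemma mem_parkingPoints_of_le_perm {a : Fin n → ℕ} (π : Equiv.Perm (Fin n))
    (h : ∀ i, 1 ≤ a i ∧ a i ≤ (π i : ℕ) + 1) : (fun i => (a i : ℝ)) ∈ parkingPoints n :=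
  ⟨a, isParkingFunction_iff.2 ⟨π, h⟩, fun _ => rfl⟩

lemma parkingPoints_subset : parkingPoints n ⊆ parkingPolytope n := subset_convexHull ℝ _

lemma one_le_of_mem {x : Fin n → ℝ} (hx : x ∈ parkingPolytope n) (i : Fin n) : 1 ≤ x i := by
  have : parkingPolytope n ⊆ {x | 1 ≤ x i} := by
    refine convexHull_min ?_ (convex_halfSpace_ge
      (LinearMap.proj (R := ℝ) (φ := fun _ : Fin n => ℝ) i).isLinear 1)
    rintro x ⟨a, ha, hxa⟩
    have := (ha.1 i).1
    simp only [Set.mem_ofPred_eq, hxa]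
    exact_mod_cast this
  exact this hx

lemma sum_le_topSum_of_mem {x : Fin n → ℝ} (hx : x ∈ parkingPolytope n) (U : Finset (Fin n)) :
    ∑ i ∈ U, x i ≤ topSum n #U := by
  have : parkingPolytope n ⊆ {x | ∑ i ∈ U, x i ≤ topSum n #U} := by
    refine convexHull_min ?_ (convex_halfSpace_le (f := fun x : Fin n → ℝ => ∑ i ∈ U, x i)
      ⟨fun x y => by simp [sum_add_distrib], fun c x => by simp [mul_sum]⟩ _)
    rintro x ⟨a, ha, hxa⟩
    obtain ⟨π, hπ⟩ := isParkingFunction_iff.1 ha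
    refine le_trans (sum_le_sum fun i _ => ?_) (perm_sum_le_topSum π U)
    rw [hxa]
    exact_mod_cast (hπ i).2
  exact this hx

/-! ### Faces as sets of maximizers -/

/-- Finite layer-cake principle: if `y` has nonnegative sum over every superlevel set of a
nonnegative weight `c`, then `c ⬝ᵥ y ≥ 0`, with equality only if all those sums vanish. -/
lemma layer_cake {ι : Type*} [Fintype ι] (y : ι → ℝ) (c : ι → ℝ) (hc : ∀ i, 0 ≤ c i)
    (h : ∀ i, 0 < c i → 0 ≤ ∑ k with c i ≤ c k, y k) :
    0 ≤ c ⬝ᵥ y ∧ (c ⬝ᵥ y = 0 → ∀ i, 0 < c i → ∑ k with c i ≤ c k, y k = 0) := by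
  classical
  induction hm : #{i | 0 < c i} using Nat.strong_induction_on generalizing c with
  | _ m ih =>
  by_cases hne : ({i | 0 < c i} : Finset ι).Nonempty
  swap
  · have h0 : ∀ i, ¬ 0 < c i := by
      simpa [Finset.not_nonempty_iff_eq_empty, filter_eq_empty_iff] using hne
    have : c ⬝ᵥ y = 0 := sum_eq_zero fun i _ => by
      rw [le_antisymm (not_lt.1 (h0 i)) (hc i), zero_mul]
    exact ⟨this.ge, fun _ i hi => absurd hi (h0 i)⟩
  -- peel off the lowest layer, whose height is the least positive value of `c`
  obtain ⟨i₀, hi₀, hmin⟩ := exists_min_image _ c hne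
  have hi₀ : 0 < c i₀ := by simpa using hi₀
  have hmin : ∀ i, 0 < c i → c i₀ ≤ c i := fun i hi => hmin i (by simpa using hi)
  have hset : ∀ k, c i₀ ≤ c k ↔ 0 < c k := fun k => ⟨fun hk => hi₀.trans_le hk, hmin k⟩
  let c' : ι → ℝ := fun i => if 0 < c i then c i - c i₀ else 0
  have hc' : ∀ i, 0 ≤ c' i := by
    intro i
    by_cases hi : 0 < c i
    · simpa [c', hi] using hmin i hi
    · simp [c', hi]
  have hpos : ∀ i, 0 < c' i ↔ c i₀ < c i := by
    intro i
    by_cases hi : 0 < c i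
    · simp [c', hi]
    · simp only [c', hi, if_false, lt_irrefl, false_iff]
      intro h; exact hi (hi₀.trans h)
  have hlev : ∀ i, 0 < c' i → ∀ k, c' i ≤ c' k ↔ c i ≤ c k := by
    intro i hi k
    have h1 : 0 < c i := hi₀.trans ((hpos i).1 hi)
    by_cases hk : 0 < c k
    · simp [c', hk, h1]
    · have e1 : c' k = 0 := by simp [c', hk]
      rw [e1]
      exact ⟨fun h => absurd hi (not_lt.2 h), fun h => absurd (h1.trans_le h) hk⟩
  have hcard : #{i | 0 < c' i} < m := by
    rw [← hm]
    refine card_lt_card ⟨fun i hi => ?_, fun hsub => ?_⟩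
    · simp only [mem_filter, mem_univ, true_and] at hi ⊢
      exact hi₀.trans ((hpos i).1 hi)
    · have := @hsub i₀ (by simpa using hi₀)
      simp [hpos] at this
  have key := ih _ hcard c' hc' (fun i hi => by
    have := h i (hi₀.trans ((hpos i).1 hi))
    simpa only [hlev i hi] using this) rfl
  have hdot : c ⬝ᵥ y = c i₀ * ∑ k with c i₀ ≤ c k, y k + c' ⬝ᵥ y := by
    simp only [dotProduct, sum_filter, mul_sum, ← sum_add_distrib, hset]
    refine sum_congr rfl fun i _ => ?_
    by_cases hi : 0 < c i
    · simp only [hi, if_true, c']; ring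
    · have : c i = 0 := le_antisymm (not_lt.1 hi) (hc i)
      simp [c', this]
  have h0 := mul_nonneg hi₀.le (h i₀ hi₀)
  refine ⟨by rw [hdot]; linarith [key.1], fun hz i hi => ?_⟩
  have hz1 : c i₀ * ∑ k with c i₀ ≤ c k, y k = 0 := by linarith [key.1]
  have hz2 : c' ⬝ᵥ y = 0 := by linarith [key.1]
  rcases (hmin i hi).eq_or_lt with heq | hlt
  · rw [← heq]
    exact (mul_eq_zero.1 hz1).resolve_left hi₀.ne'
  · have hi' := (hpos i).2 hlt
    have := key.2 hz2 i hi'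
    simpa only [hlev i hi'] using this

lemma exists_perm_of_levels {β : Type*} [LinearOrder β] (t : Fin n → β) :
    ∃ π : Equiv.Perm (Fin n), ∀ i k, t i < t k → π i < π k := by
  refine ⟨(Tuple.sort t)⁻¹, fun i k h => ?_⟩
  by_contra! hle
  have := Tuple.monotone_sort t hle
  simp at this
  exact absurd h (not_lt.2 this)

/-- The points of the polytope at which every inequality `1 ≤ x i` with `c i < 0`, and every
inequality for the sum over a superlevel set of `c` at a positive level, is tight. -/
def tightFace (c : Fin n → ℝ) : Set (Fin n → ℝ) :=
  {x | x ∈ parkingPolytope n ∧ (∀ i, c i < 0 → x i = 1) ∧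
    ∀ i, 0 < c i → ∑ k with c i ≤ c k, x k = topSum n #{k | c i ≤ c k}}

lemma tightFace_nonempty (c : Fin n → ℝ) : (tightFace c).Nonempty := by
  obtain ⟨π, hπ⟩ := exists_perm_of_levels c
  let a : Fin n → ℕ := fun i => if c i < 0 then 1 else π i + 1
  refine ⟨fun i => (a i : ℝ), parkingPoints_subset (mem_parkingPoints_of_le_perm π fun i => ?_),
    fun i hi => by simp [a, hi], fun i hi => ?_⟩
  · simp only [a]; split_ifs <;> omega
  · rw [← (perm_sum_eq_topSum_iff π _).2]
    · refine sum_congr rfl fun k hk => ?_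
      have hk' : ¬ c k < 0 := not_lt.2 (hi.le.trans (by simpa using hk))
      simp [a, hk']
    · intro j hj k hk
      simp only [mem_filter, mem_univ, true_and, not_le] at hj hk
      exact hπ k j (hk.trans_le hj)

/-- The points of `tightFace c` are exactly the maximizers of the functional `c`. -/
lemma dotProduct_le_of_mem_tightFace {c z x : Fin n → ℝ} (hz : z ∈ tightFace c)
    (hx : x ∈ parkingPolytope n) : c ⬝ᵥ x ≤ c ⬝ᵥ z ∧ (c ⬝ᵥ x = c ⬝ᵥ z ↔ x ∈ tightFace c) := by
  obtain ⟨hzP, hz1, hz2⟩ := hz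
  let cp : Fin n → ℝ := fun i => max (c i) 0
  let cm : Fin n → ℝ := fun i => max (-c i) 0
  let y : Fin n → ℝ := fun i => z i - x i
  have hcp : ∀ i, 0 ≤ cp i := fun i => le_max_right _ _
  have hpos : ∀ i, 0 < cp i ↔ 0 < c i := fun i => by simp [cp]
  have hlev : ∀ i, 0 < cp i → ∀ k, cp i ≤ cp k ↔ c i ≤ c k := by
    intro i hi k
    have hi' := (hpos i).1 hi
    have e : cp i = c i := max_eq_left hi'.le
    rw [e]
    simp only [cp, le_max_iff, or_iff_left_iff_imp]
    intro h; exact absurd hi' (not_lt.2 h)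
  have hdot : c ⬝ᵥ z - c ⬝ᵥ x = cp ⬝ᵥ y + ∑ i, cm i * (x i - z i) := by
    simp only [dotProduct, ← sum_sub_distrib, ← sum_add_distrib]
    refine sum_congr rfl fun i _ => ?_
    have : c i = cp i - cm i := by
      simp only [cp, cm]
      rcases le_total (c i) 0 with h | h
      · rw [max_eq_right h, max_eq_left (by linarith)]; ring
      · rw [max_eq_left h, max_eq_right (by linarith)]; ring
    rw [this]; simp only [y]; ring
  have hsum : ∀ i, 0 < c i → ∑ k with c i ≤ c k, y k =
      topSum n #{k | c i ≤ c k} - ∑ k with c i ≤ c k, x k := fun i hi => by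
    simp only [y]
    rw [sum_sub_distrib, hz2 i hi]
  have key := layer_cake y cp hcp (fun i hi => by
    simp only [hlev i hi]
    rw [hsum i ((hpos i).1 hi)]
    linarith [sum_le_topSum_of_mem hx {k | c i ≤ c k}])
  have hneg : ∀ i ∈ univ, 0 ≤ cm i * (x i - z i) := by
    intro i _
    by_cases hi : c i < 0
    · rw [hz1 i hi]
      exact mul_nonneg (le_max_right _ _) (by linarith [one_le_of_mem hx i])
    · have : cm i = 0 := max_eq_right (by linarith)
      simp [this]
  have hneg' := sum_nonneg hneg
  refine ⟨by linarith [key.1], fun heq => ⟨hx, fun i hi => ?_, fun i hi => ?_⟩, fun hxt => ?_⟩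
  · have h0 : ∑ i, cm i * (x i - z i) = 0 := by linarith [key.1]
    have := (sum_eq_zero_iff_of_nonneg hneg).1 h0 i (mem_univ i)
    have hcm : cm i ≠ 0 := by
      have : cm i = -c i := max_eq_left (by linarith)
      rw [this]; linarith
    have := (mul_eq_zero.1 this).resolve_left hcm
    rw [hz1 i hi] at this
    linarith
  · have h0 : cp ⬝ᵥ y = 0 := by linarith [key.1]
    have := key.2 h0 i ((hpos i).2 hi)
    simp only [hlev i ((hpos i).2 hi)] at this
    rw [hsum i hi] at this
    linarith
  · have h1 : ∑ i, cm i * (x i - z i) = 0 := sum_eq_zero fun i _ => by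
      by_cases hi : c i < 0
      · rw [hz1 i hi, hxt.2.1 i hi]; ring
      · have : cm i = 0 := max_eq_right (by linarith)
        simp [this]
    have h2 := layer_cake (-y) cp hcp (fun i hi => by
      simp only [hlev i hi, Pi.neg_apply, sum_neg_distrib]
      rw [hsum i ((hpos i).1 hi), hxt.2.2 i ((hpos i).1 hi)]
      simp)
    rw [dotProduct_neg] at h2
    linarith [key.1, h2.1]

/-- The nonempty faces are the sets of maximizers of the linear functionals. -/
lemma isFace_nonempty_iff {F : Set (Fin n → ℝ)} :
    IsFace (parkingPolytope n) F ∧ F.Nonempty ↔ ∃ c : Fin n → ℝ, F = tightFace c := by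
  constructor
  · rintro ⟨⟨c, d, hd, rfl⟩, ⟨x₀, hx₀, hx₀d⟩⟩
    refine ⟨c, ?_⟩
    obtain ⟨z, hz⟩ := tightFace_nonempty c
    have hzd : c ⬝ᵥ z = d := le_antisymm (hd z hz.1)
      (hx₀d ▸ (dotProduct_le_of_mem_tightFace hz hx₀).1)
    ext x
    constructor
    · rintro ⟨hx, hxd⟩
      exact (dotProduct_le_of_mem_tightFace hz hx).2.1 (hxd.trans hzd.symm)
    · intro hx
      exact ⟨hx.1, ((dotProduct_le_of_mem_tightFace hz hx.1).2.2 hx).trans hzd⟩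
  · rintro ⟨c, rfl⟩
    refine ⟨?_, tightFace_nonempty c⟩
    obtain ⟨z, hz⟩ := tightFace_nonempty c
    refine ⟨c, c ⬝ᵥ z, fun x hx => (dotProduct_le_of_mem_tightFace hz hx).1, ?_⟩
    ext x
    exact ⟨fun hx => ⟨hx.1, (dotProduct_le_of_mem_tightFace hz hx.1).2.2 hx⟩,
      fun hx => (dotProduct_le_of_mem_tightFace hz hx.1).2.1 hx.2⟩

/-! ### Two facts from linear algebra -/

/-- If a subspace contains the basis vectors of unclassed indices and the differences of basis
vectors within each class, and all its members sum to zero over each class, then its codimension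
is the number of classes. -/
lemma finrank_add_card_of_classes {ι J : Type*} [Fintype ι] [DecidableEq ι] [Fintype J]
    [DecidableEq J] (q : ι → Option J) (hq : ∀ j, ∃ i, q i = some j) (D : Submodule ℝ (ι → ℝ))
    (h1 : ∀ i, q i = none → Pi.single i 1 ∈ D)
    (h2 : ∀ i k, q i = q k → q i ≠ none → (Pi.single i 1 - Pi.single k 1 : ι → ℝ) ∈ D)
    (h3 : ∀ v ∈ D, ∀ j, ∑ i with q i = some j, v i = 0) :
    Module.finrank ℝ D + Fintype.card J = Fintype.card ι := by
  choose s hs using hq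
  let L : (ι → ℝ) →ₗ[ℝ] (J → ℝ) :=
    LinearMap.pi fun j => ∑ i with q i = some j, LinearMap.proj i
  have hL : ∀ v j, L v j = ∑ i with q i = some j, v i := fun v j => by
    simp [L, LinearMap.sum_apply]
  have hker : D = LinearMap.ker L := by
    refine le_antisymm (fun v hv => ?_) (fun v hv => ?_)
    · rw [LinearMap.mem_ker]
      ext j
      rw [hL, h3 v hv j]
      rfl
    · have hv : ∀ j, ∑ i with q i = some j, v i = 0 := fun j => by
        rw [← hL, LinearMap.mem_ker.1 hv]; rfl
      -- subtract from every basis vector the one of the representative of its class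
      let b : Option J → (ι → ℝ) := fun o => o.elim 0 fun j => Pi.single (s j) 1
      have hb : ∑ i, v i • b (q i) = 0 := by
        have : ∀ i, v i • b (q i) =
            ∑ j, if q i = some j then v i • (Pi.single (s j) 1 : ι → ℝ) else 0 := by
          intro i
          rcases h : q i with _ | j
          · simp [b]
          · simp [b]
        simp only [this]
        rw [sum_comm]
        refine sum_eq_zero fun j _ => ?_
        rw [← sum_filter, ← sum_smul, hv j, zero_smul]
      have hvsum : v = ∑ i, v i • ((Pi.single i 1 : ι → ℝ) - b (q i)) := by
        simp only [smul_sub, sum_sub_distrib, hb, sub_zero]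
        ext k
        simp [Finset.sum_apply, Pi.single_apply]
      rw [hvsum]
      refine Submodule.sum_mem _ fun i _ => Submodule.smul_mem _ _ ?_
      rcases h : q i with _ | j
      · simpa [b] using h1 i h
      · exact h2 i (s j) (by rw [h, hs]) (by simp [h])
  have hsurj : LinearMap.range L = ⊤ := by
    rw [LinearMap.range_eq_top]
    intro w
    refine ⟨∑ j, w j • Pi.single (s j) 1, ?_⟩
    ext j
    rw [hL]
    simp only [Finset.sum_apply, Pi.smul_apply, smul_eq_mul]
    rw [sum_comm, sum_eq_single j]
    · rw [← mul_sum]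
      simp [Pi.single_apply, hs]
    · intro j' _ hj'
      rw [← mul_sum]
      simp [Pi.single_apply, hs, hj']
    · simp
  have := LinearMap.finrank_range_add_finrank_ker L
  rw [hsurj, finrank_top, Module.finrank_fintype_fun_eq_card,
    Module.finrank_fintype_fun_eq_card] at this
  rw [hker]
  omega

lemma apply_eq_zero_of_mem_vectorSpan {E : Type*} [AddCommGroup E] [Module ℝ E] {S : Set E}
    (f : E →ₗ[ℝ] ℝ) (d : ℝ) (h : ∀ x ∈ S, f x = d) : ∀ v ∈ vectorSpan ℝ S, f v = 0 := by
  intro v hv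
  have : vectorSpan ℝ S ≤ LinearMap.ker f := by
    rw [vectorSpan, Submodule.span_le]
    rintro _ ⟨x, hx, y, hy, rfl⟩
    simp [h x hx, h y hy]
  exact LinearMap.mem_ker.1 (this hv)

/-! ### Faces and level functions -/

/-- The face encoded by a level function `t`: coordinates of level `0` equal `1`, coordinates of
level `1` are unconstrained, and the coordinates of level at least `θ`, for each `θ ≥ 2`, have
the largest possible sum. -/
def levelFace (t : Fin n → ℕ) : Set (Fin n → ℝ) :=
  {x | x ∈ parkingPolytope n ∧ (∀ i, t i = 0 → x i = 1) ∧
    ∀ θ, 2 ≤ θ → ∑ k with θ ≤ t k, x k = topSum n #{k | θ ≤ t k}}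

/-- Every level above `2` that is attained has an attained predecessor; thus the levels `≥ 2`
form an interval starting at `2`. -/
def GapFree (t : Fin n → ℕ) : Prop := ∀ i, 3 ≤ t i → ∃ k, t k + 1 = t i

/-- The codimension of the face encoded by a level function `t` with `#{i | t i ≤ 1} ≠ 1`. -/
def levelCodim (t : Fin n → ℕ) : ℕ := #{i | t i = 0} + #{v ∈ univ.image t | 2 ≤ v}

lemma tightFace_eq_levelFace {c : Fin n → ℝ} {t : Fin n → ℕ} (h0 : ∀ i, c i < 0 ↔ t i = 0)
    (h1 : ∀ i, 0 < c i ↔ 2 ≤ t i) (h2 : ∀ i k, 2 ≤ t i → (c i ≤ c k ↔ t i ≤ t k)) :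
    tightFace c = levelFace t := by
  ext x
  simp only [tightFace, levelFace, Set.mem_ofPred_eq, h0, h1]
  refine and_congr_right fun _ => and_congr_right fun _ => ⟨fun h θ hθ => ?_, fun h i hi => ?_⟩
  · by_cases hne : ({k | θ ≤ t k} : Finset (Fin n)).Nonempty
    · obtain ⟨i, hi, hmin⟩ := exists_min_image _ t hne
      have hi : θ ≤ t i := by simpa using hi
      have hset : ∀ k, θ ≤ t k ↔ c i ≤ c k := fun k => by
        rw [h2 i k (hθ.trans hi)]
        exact ⟨fun hk => hmin k (by simpa using hk), hi.trans⟩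
      simpa only [hset] using h i (hθ.trans hi)
    · rw [not_nonempty_iff_eq_empty] at hne
      rw [hne, sum_empty, card_empty, topSum_zero]
  · simpa only [h2 i _ hi] using h (t i) hi

lemma levelFace_eq_tightFace (t : Fin n → ℕ) : levelFace t = tightFace fun i => (t i : ℝ) - 1 := by
  refine (tightFace_eq_levelFace (fun i => ?_) (fun i => ?_) (fun i k _ => ?_)).symm
  · rw [sub_neg, Nat.cast_lt_one]
  · rw [sub_pos, Nat.one_lt_cast]; rfl
  · rw [sub_le_sub_iff_right, Nat.cast_le]

/-- Ranking the positive values of `c` gives a gap-free level function with the same face. -/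
lemma exists_gapFree_tightFace_eq (c : Fin n → ℝ) :
    ∃ t : Fin n → ℕ, GapFree t ∧ tightFace c = levelFace t := by
  classical
  let V : ℝ → Finset ℝ := fun w => {v ∈ univ.image c | 0 < v ∧ v ≤ w}
  have hmemV : ∀ {w v}, v ∈ V w ↔ (∃ k, c k = v) ∧ 0 < v ∧ v ≤ w := by
    intro w v; simp [V]
  let t : Fin n → ℕ := fun i => if c i < 0 then 0 else 1 + #(V (c i))
  have hV0 : ∀ {w}, w ≤ 0 → #(V w) = 0 := by
    intro w hw
    rw [card_eq_zero, eq_empty_iff_forall_notMem]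
    intro v hv
    have := hmemV.1 hv
    linarith
  have hle : ∀ i, ¬ 0 < c i → t i ≤ 1 := by
    intro i hi
    simp only [t]
    split_ifs
    · exact zero_le_one
    · rw [hV0 (not_lt.1 hi)]
  have hpos : ∀ i, 0 < c i → t i = 1 + #(V (c i)) := fun i hi => by
    simp [t, hi.le]
  have hself : ∀ i, 0 < c i → c i ∈ V (c i) := fun i hi => hmemV.2 ⟨⟨i, rfl⟩, hi, le_rfl⟩
  have h1 : ∀ i, 0 < c i ↔ 2 ≤ t i := by
    refine fun i => ⟨fun hi => ?_, fun hi => ?_⟩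
    · have := card_pos.2 ⟨_, hself i hi⟩
      rw [hpos i hi]; omega
    · by_contra hn
      have := hle i hn
      omega
  refine ⟨t, fun i hi => ?_, tightFace_eq_levelFace (fun i => ?_) h1 (fun i k hi => ?_)⟩
  · have hci : 0 < c i := (h1 i).2 (by omega)
    have hne : ((V (c i)).erase (c i)).Nonempty := by
      rw [← card_pos, card_erase_of_mem (hself i hci)]
      have := hpos i hci
      omega
    -- the next smaller positive value of `c`
    obtain ⟨w, hw, hmax⟩ := exists_max_image _ id hne
    have hw1 := hmemV.1 (mem_of_mem_erase hw)
    obtain ⟨⟨k, rfl⟩, hk0, hki⟩ := hw1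
    have hV : V (c k) = (V (c i)).erase (c i) := by
      ext v
      rw [mem_erase, hmemV, hmemV]
      have hlt : c k < c i := lt_of_le_of_ne hki (ne_of_mem_erase hw)
      constructor
      · rintro ⟨h, h', h''⟩
        exact ⟨(h''.trans_lt hlt).ne, h, h', h''.trans hki⟩
      · rintro ⟨hne, h, h', h''⟩
        exact ⟨h, h', hmax v (mem_erase.2 ⟨hne, hmemV.2 ⟨h, h', h''⟩⟩)⟩
    refine ⟨k, ?_⟩
    rw [hpos k hk0, hpos i hci, hV, card_erase_of_mem (hself i hci)]
    have := hpos i hci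
    omega
  · simp [t]
  · have hci := (h1 i).2 hi
    constructor
    · intro hik
      rw [hpos i hci, hpos k (hci.trans_le hik)]
      refine Nat.add_le_add_left (card_le_card fun v hv => ?_) 1
      have := hmemV.1 hv
      exact hmemV.2 ⟨this.1, this.2.1, this.2.2.trans hik⟩
    · intro hik
      by_contra! hlt
      have hck : 0 < c k := (h1 k).2 (hi.trans hik)
      rw [hpos i hci, hpos k hck] at hik
      have : V (c k) ⊂ V (c i) := by
        refine ⟨fun v hv => ?_, fun hsub => ?_⟩
        · have := hmemV.1 hv
          exact hmemV.2 ⟨this.1, this.2.1, this.2.2.trans hlt.le⟩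
        · exact absurd (hmemV.1 (hsub (hself i hci))).2.2 (not_le.2 hlt)
      have := card_lt_card this
      omega

/-- If exactly one coordinate has level at most `1`, it is forced to equal `1`, and the face is
the same as when this coordinate forms the lowest of the blocks of level `≥ 2`. -/
lemma exists_nondegenerate (t : Fin n → ℕ) (ht : GapFree t) :
    ∃ u : Fin n → ℕ, GapFree u ∧ #{i | u i ≤ 1} ≠ 1 ∧ levelFace t = levelFace u := by
  by_cases h : #{i | t i ≤ 1} = 1
  swap
  · exact ⟨t, ht, h, rfl⟩
  obtain ⟨i₀, hi₀⟩ := card_eq_one.1 h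
  have hiff : ∀ i, t i ≤ 1 ↔ i = i₀ := fun i => by
    rw [← mem_singleton, ← hi₀]; simp
  have h0 := (hiff i₀).2 rfl
  let u : Fin n → ℕ := fun i => if t i ≤ 1 then 2 else t i + 1
  have hu0 : u i₀ = 2 := if_pos h0
  have hu2 : ∀ i, 2 ≤ u i := fun i => by
    simp only [u]; split_ifs <;> omega
  have hus : ∀ θ, 2 ≤ θ → ∀ i, θ + 1 ≤ u i ↔ θ ≤ t i := fun θ hθ i => by
    simp only [u]; split_ifs <;> omega
  refine ⟨u, fun i hi => ?_, ?_, ?_⟩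
  · have hti : 2 ≤ t i := (hus 2 le_rfl i).1 hi
    have hui : u i = t i + 1 := if_neg (by omega)
    rcases hti.eq_or_lt with h2 | h2
    · exact ⟨i₀, by omega⟩
    · obtain ⟨k, hk⟩ := ht i h2
      have : u k = t k + 1 := if_neg (by omega)
      exact ⟨k, by omega⟩
  · have : #{i | u i ≤ 1} = 0 := by
      rw [card_eq_zero, filter_eq_empty_iff]
      intro i _
      have := hu2 i
      omega
    omega
  · have huniv : ({k | 2 ≤ u k} : Finset (Fin n)) = univ := by
      ext k; simp [hu2]
    have herase : ({k | 2 ≤ t k} : Finset (Fin n)) = univ.erase i₀ := by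
      ext k
      have := hiff k
      simp only [mem_filter, mem_univ, true_and, mem_erase, and_true, ne_eq, ← this]
      omega
    have hn : 1 ≤ n := by have := i₀.2; omega
    have htop : topSum n n = topSum n (n - 1) + 1 := by
      have e : topSet n n = insert ⟨0, hn⟩ (topSet n (n - 1)) := by
        ext i
        rw [mem_insert, mem_topSet, mem_topSet, Fin.ext_iff]
        simp only
        omega
      have hnot : (⟨0, hn⟩ : Fin n) ∉ topSet n (n - 1) := by
        rw [mem_topSet]; simp only; omega
      rw [topSum, e, sum_insert hnot, topSum]
      push_cast
      ring
    have hcard : #(univ.erase i₀) = n - 1 := by simp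
    ext x
    simp only [levelFace, Set.mem_ofPred_eq]
    refine and_congr_right fun hx => ?_
    have hsum : ∑ k, x k = ∑ k ∈ univ.erase i₀, x k + x i₀ :=
      (sum_erase_add _ _ (mem_univ i₀)).symm
    constructor
    · rintro ⟨-, h2⟩
      have htight := h2 2 le_rfl
      rw [herase, hcard] at htight
      have hle := sum_le_topSum_of_mem hx univ
      rw [card_univ, Fintype.card_fin] at hle
      have hge := one_le_of_mem hx i₀
      refine ⟨fun i hi => absurd (hu2 i) (by omega), fun θ hθ => ?_⟩
      rcases hθ.eq_or_lt with rfl | hlt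
      · rw [huniv, card_univ, Fintype.card_fin]
        linarith
      · obtain ⟨θ, rfl⟩ : ∃ m, θ = m + 1 := ⟨θ - 1, by omega⟩
        simp only [hus θ (by omega)]
        exact h2 θ (by omega)
    · rintro ⟨-, h2⟩
      have h2' : ∀ θ, 2 ≤ θ → ∑ k with θ ≤ t k, x k = topSum n #{k | θ ≤ t k} := fun θ hθ => by
        simpa only [hus θ hθ] using h2 (θ + 1) (by omega)
      refine ⟨fun i hi => ?_, h2'⟩
      obtain rfl := (hiff i).1 (by omega)
      have htight := h2' 2 le_rfl
      rw [herase, hcard] at htight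
      have hall := h2 2 le_rfl
      rw [huniv, card_univ, Fintype.card_fin] at hall
      linarith

/-! ### The dimension of a face -/

/-- A sequence below a permutation compatible with `t` lies in the face of `t` as soon as it agrees
with the permutation on the levels `≥ 2` and is `1` on level `0`. -/
lemma mem_levelFace_of_perm {t : Fin n → ℕ} {π : Equiv.Perm (Fin n)}
    (hπ : ∀ i k, t i < t k → π i < π k) {a : Fin n → ℕ}
    (h : ∀ i, 1 ≤ a i ∧ a i ≤ (π i : ℕ) + 1) (h0 : ∀ i, t i = 0 → a i = 1)
    (h2 : ∀ i, 2 ≤ t i → a i = π i + 1) : (fun i => (a i : ℝ)) ∈ levelFace t := by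
  refine ⟨parkingPoints_subset (mem_parkingPoints_of_le_perm π h), fun i hi => by simp [h0 i hi],
    fun θ hθ => ?_⟩
  rw [← (perm_sum_eq_topSum_iff π _).2]
  · refine sum_congr rfl fun k hk => ?_
    simp only [h2 k (hθ.trans (by simpa using hk))]
    push_cast
    rfl
  · intro j hj k hk
    simp only [mem_filter, mem_univ, true_and, not_le] at hj hk
    exact hπ k j (hk.trans_le hj)

lemma levelVertex_mem {t : Fin n → ℕ} {π : Equiv.Perm (Fin n)}
    (hπ : ∀ i k, t i < t k → π i < π k) :
    (fun i => ((if t i = 0 then 1 else (π i : ℕ) + 1 : ℕ) : ℝ)) ∈ levelFace t := by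
  refine mem_levelFace_of_perm hπ (fun i => ?_) (fun i hi => if_pos hi)
    (fun i hi => if_neg (by omega))
  split_ifs <;> omega

lemma swap_compatible {t : Fin n → ℕ} {π : Equiv.Perm (Fin n)}
    (hπ : ∀ i k, t i < t k → π i < π k) {i k : Fin n} (hik : t i = t k) :
    ∀ j l, t j < t l → (Equiv.swap i k).trans π j < (Equiv.swap i k).trans π l := by
  have ht : ∀ j, t (Equiv.swap i k j) = t j := by
    intro j
    rcases eq_or_ne j i with rfl | h1
    · simp [hik]
    · rcases eq_or_ne j k with rfl | h2
      · simp [hik]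
      · rw [Equiv.swap_apply_of_ne_of_ne h1 h2]
  intro j l hjl
  exact hπ _ _ (by rwa [ht, ht])

/-- Swapping two distinct values on the same nonzero level moves within the face. -/
lemma single_sub_single_mem {t : Fin n → ℕ} {i k : Fin n} (hik : t i = t k) (h0 : t i ≠ 0) :
    (Pi.single i 1 - Pi.single k 1 : Fin n → ℝ) ∈ vectorSpan ℝ (levelFace t) := by
  rcases eq_or_ne i k with rfl | hne
  · simp
  obtain ⟨π, hπ⟩ := exists_perm_of_levels t
  have hmem := vsub_mem_vectorSpan ℝ (levelVertex_mem hπ)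
    (levelVertex_mem (swap_compatible hπ hik))
  have hd : ((π i : ℕ) : ℝ) - (π k : ℕ) ≠ 0 := by
    rw [sub_ne_zero]
    intro h
    exact hne (π.injective (Fin.ext (by exact_mod_cast h)))
  rw [← Submodule.smul_mem_iff _ hd]
  convert hmem using 1
  ext j
  simp only [Pi.smul_apply, Pi.sub_apply, smul_eq_mul, vsub_eq_sub, Equiv.trans_apply]
  rcases eq_or_ne j i with rfl | h1
  · simp [h0, hne]
  · rcases eq_or_ne j k with rfl | h2
    · simp [← hik, h0, h1]
    · simp [h1, h2, Equiv.swap_apply_of_ne_of_ne h1 h2]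

/-- A coordinate of level `1` can be given a rank above `0`: otherwise it would be the only one of
level at most `1`. -/
lemma exists_perm_pos_of_free {t : Fin n → ℕ} (ht : #{i | t i ≤ 1} ≠ 1) {i : Fin n}
    (hi : t i = 1) : ∃ π : Equiv.Perm (Fin n), (∀ j k, t j < t k → π j < π k) ∧ 0 < (π i : ℕ) := by
  obtain ⟨π, hπ⟩ := exists_perm_of_levels t
  by_cases h0 : 0 < (π i : ℕ)
  · exact ⟨π, hπ, h0⟩
  have hcard : 1 < #{i | t i ≤ 1} := by
    have : 0 < #{i | t i ≤ 1} := card_pos.2 ⟨i, by simp [hi]⟩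
    omega
  obtain ⟨k, hk, hki⟩ := exists_mem_ne hcard i
  have hk : t k ≤ 1 := by simpa using hk
  have hπk : π k ≠ π i := fun h => hki (π.injective h)
  have hki' : t i = t k := by
    by_contra hne
    have := Fin.lt_def.1 (hπ k i (by omega))
    omega
  refine ⟨(Equiv.swap i k).trans π, swap_compatible hπ hki', ?_⟩
  rw [Equiv.trans_apply, Equiv.swap_apply_left]
  rw [ne_eq, Fin.ext_iff] at hπk
  omega

/-- Lowering a coordinate of level `1` from a value above `1` down to `1` moves within the face. -/
lemma single_mem {t : Fin n → ℕ} (ht : #{i | t i ≤ 1} ≠ 1) {i : Fin n} (hi : t i = 1) :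
    (Pi.single i 1 : Fin n → ℝ) ∈ vectorSpan ℝ (levelFace t) := by
  obtain ⟨π, hπ, hpos⟩ := exists_perm_pos_of_free ht hi
  have hmem2 : (fun j => ((if t j = 0 ∨ j = i then 1 else (π j : ℕ) + 1 : ℕ) : ℝ)) ∈
      levelFace t := by
    refine mem_levelFace_of_perm hπ (fun j => ?_) (fun j hj => if_pos (Or.inl hj))
      (fun j hj => if_neg ?_)
    · split_ifs <;> omega
    · rintro (h | rfl) <;> omega
  have hmem := vsub_mem_vectorSpan ℝ (levelVertex_mem hπ) hmem2
  have hd : ((π i : ℕ) : ℝ) ≠ 0 := by exact_mod_cast hpos.ne'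
  rw [← Submodule.smul_mem_iff _ hd]
  convert hmem using 1
  ext j
  simp only [Pi.smul_apply, smul_eq_mul, vsub_eq_sub, Pi.sub_apply]
  rcases eq_or_ne j i with rfl | h1
  · simp [hi]
  · simp [h1]

lemma finrank_levelFace {t : Fin n → ℕ} (ht : #{i | t i ≤ 1} ≠ 1) :
    Module.finrank ℝ (affineSpan ℝ (levelFace t)).direction + levelCodim t = n := by
  rw [direction_affineSpan]
  let B : Finset ℕ := {v ∈ univ.image t | 2 ≤ v}
  have hB : ∀ {v}, v ∈ B ↔ (∃ i, t i = v) ∧ 2 ≤ v := by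
    intro v; simp [B]
  -- the classes: a singleton for each coordinate of level `0`, and the blocks of level `≥ 2`
  let q : Fin n → Option ({i // t i = 0} ⊕ {v // v ∈ B}) := fun i =>
    if h0 : t i = 0 then some (Sum.inl ⟨i, h0⟩)
    else if h2 : 2 ≤ t i then some (Sum.inr ⟨t i, hB.2 ⟨⟨i, rfl⟩, h2⟩⟩) else none
  have hq0 : ∀ i (h0 : t i = 0), q i = some (Sum.inl ⟨i, h0⟩) := fun i h0 => dif_pos h0
  have hq2 : ∀ i (h2 : 2 ≤ t i), q i = some (Sum.inr ⟨t i, hB.2 ⟨⟨i, rfl⟩, h2⟩⟩) := by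
    intro i h2
    simp only [q]
    rw [dif_neg (by omega), dif_pos h2]
  have hq1 : ∀ i, t i = 1 → q i = none := by
    intro i h1
    simp only [q]
    rw [dif_neg (by omega), dif_neg (by omega)]
  have hinl : ∀ i j, q i = some (Sum.inl j) ↔ i = j.1 := by
    rintro i ⟨j, hj⟩
    constructor
    · intro h
      rcases lt_trichotomy (t i) 1 with h' | h' | h'
      · rw [hq0 i (by omega)] at h; simpa using h
      · rw [hq1 i h'] at h; simp at h
      · rw [hq2 i h'] at h; simp at h
    · rintro rfl
      exact hq0 i hj
  have hinr : ∀ i j, q i = some (Sum.inr j) ↔ t i = j.1 := by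
    rintro i ⟨j, hj⟩
    have hj2 := (hB.1 hj).2
    constructor
    · intro h
      rcases lt_trichotomy (t i) 1 with h' | h' | h'
      · rw [hq0 i (by omega)] at h; simp at h
      · rw [hq1 i h'] at h; simp at h
      · rw [hq2 i h'] at h; simpa using h
    · rintro rfl
      exact hq2 i hj2
  have key := finrank_add_card_of_classes q ?_ (vectorSpan ℝ (levelFace t)) ?_ ?_ ?_
  · rw [Fintype.card_sum, Fintype.card_subtype, Fintype.card_coe, Fintype.card_fin] at key
    exact key
  · rintro (j | j)
    · exact ⟨j.1, (hinl _ _).2 rfl⟩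
    · obtain ⟨i, hi⟩ := (hB.1 j.2).1
      exact ⟨i, (hinr _ _).2 hi⟩
  · intro i hi
    refine single_mem ht ?_
    by_contra h1
    rcases Nat.lt_or_ge (t i) 2 with h | h
    · rw [hq0 i (by omega)] at hi; simp at hi
    · rw [hq2 i h] at hi; simp at hi
  · intro i k hik hne
    rcases h : q k with _ | (j | j)
    · exact absurd (hik.trans h) hne
    · rw [h, hinl] at hik
      rw [hinl] at h
      rw [hik, h, sub_self]
      exact Submodule.zero_mem _
    · rw [h, hinr] at hik
      rw [hinr] at h
      refine single_sub_single_mem (hik.trans h.symm) ?_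
      have := (hB.1 j.2).2
      omega
  · rintro v hv (j | j)
    · simp only [hinl]
      rw [filter_eq', if_pos (mem_univ _), sum_singleton]
      exact apply_eq_zero_of_mem_vectorSpan (LinearMap.proj j.1) 1
        (fun x hx => hx.2.1 j.1 j.2) v hv
    · simp only [hinr]
      have hj := (hB.1 j.2).2
      have hzero : ∀ θ, 2 ≤ θ → ∑ i with θ ≤ t i, v i = 0 := fun θ hθ => by
        have := apply_eq_zero_of_mem_vectorSpan
          (∑ i with θ ≤ t i, (LinearMap.proj i : (Fin n → ℝ) →ₗ[ℝ] ℝ)) (topSum n #{i | θ ≤ t i})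
          (fun x hx => by simpa [LinearMap.sum_apply] using hx.2.2 θ hθ) v hv
        simpa [LinearMap.sum_apply] using this
      have hsplit : ∑ i with j.1 ≤ t i, v i =
          ∑ i with t i = j.1, v i + ∑ i with j.1 + 1 ≤ t i, v i := by
        rw [← sum_union]
        · refine sum_congr ?_ fun _ _ => rfl
          ext i
          simp only [mem_filter, mem_univ, true_and, mem_union]
          omega
        · rw [disjoint_filter]
          intro i _ h
          omega
      rw [hzero _ hj, hzero _ (by omega), add_zero] at hsplit
      exact hsplit.symm

/-! ### Recovering the level function from the face -/

/-- The only sets of coordinates whose sum is maximal on the whole face are the superlevel sets. -/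
lemma tight_iff {t : Fin n → ℕ} (ht : #{i | t i ≤ 1} ≠ 1) (U : Finset (Fin n)) :
    (∀ x ∈ levelFace t, ∑ i ∈ U, x i = topSum n #U) ↔
      ∃ θ, 2 ≤ θ ∧ U = ({k | θ ≤ t k} : Finset (Fin n)) := by
  constructor
  swap
  · rintro ⟨θ, hθ, rfl⟩ x hx
    exact hx.2.2 θ hθ
  intro hU
  have hD : ∀ v ∈ vectorSpan ℝ (levelFace t), ∑ i ∈ U, v i = 0 := fun v hv => by
    have := apply_eq_zero_of_mem_vectorSpan
      (∑ i ∈ U, (LinearMap.proj i : (Fin n → ℝ) →ₗ[ℝ] ℝ)) (topSum n #U)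
      (fun x hx => by simpa [LinearMap.sum_apply] using hU x hx) v hv
    simpa [LinearMap.sum_apply] using this
  have hfree : ∀ i ∈ U, t i ≠ 1 := by
    intro i hi h1
    have := hD _ (single_mem ht h1)
    simp [Pi.single_apply, hi] at this
  have hblock : ∀ i k, t i = t k → t i ≠ 0 → i ∈ U → k ∈ U := by
    intro i k hik h0 hi
    by_contra hk
    have := hD _ (single_sub_single_mem hik h0)
    simp [Pi.single_apply, hi, hk] at this
  obtain ⟨π, hπ⟩ := exists_perm_of_levels t
  have hsum := hU _ (levelVertex_mem hπ)
  have hle : ∀ i ∈ U, ((if t i = 0 then 1 else (π i : ℕ) + 1 : ℕ) : ℝ) ≤ ((π i : ℕ) : ℝ) + 1 := by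
    intro i _
    split_ifs
    · simp
    · push_cast; exact le_rfl
  have htot : ∑ i ∈ U, (((π i : ℕ) : ℝ) + 1) = topSum n #U :=
    le_antisymm (perm_sum_le_topSum π U) (hsum ▸ sum_le_sum hle)
  have heq := (sum_eq_sum_iff_of_le hle).1 (hsum.trans htot.symm)
  have hupper := (perm_sum_eq_topSum_iff π U).1 htot
  have hforced : ∀ i ∈ U, t i ≠ 0 := by
    intro i hi h0
    have hπ0 : ∀ j ∈ U, t j = 0 → (π j : ℕ) = 0 := by
      intro j hj hj0
      have := heq j hj
      rw [if_pos hj0] at this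
      have h : (1 : ℝ) = ((π j : ℕ) + 1 : ℕ) := by exact_mod_cast this
      have h : 1 = (π j : ℕ) + 1 := by exact_mod_cast h
      omega
    have huniv : ∀ k, k ∈ U := by
      intro k
      by_contra hk
      have := Fin.lt_def.1 (hupper i hi k hk)
      rw [hπ0 i hi h0] at this
      omega
    apply ht
    rw [card_eq_one]
    refine ⟨i, ?_⟩
    ext k
    simp only [mem_filter, mem_univ, true_and, mem_singleton]
    constructor
    · intro hk
      have hk0 : t k = 0 := by
        have := hfree k (huniv k)
        omega
      exact π.injective (Fin.ext (by rw [hπ0 k (huniv k) hk0, hπ0 i hi h0]))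
    · rintro rfl
      omega
  rcases U.eq_empty_or_nonempty with rfl | hne
  · refine ⟨univ.sup t + 2, by omega, ?_⟩
    symm
    rw [filter_eq_empty_iff]
    intro k _
    have := le_sup (f := t) (mem_univ k)
    omega
  · obtain ⟨i, hi, hmin⟩ := exists_min_image U t hne
    have h0 := hforced i hi
    have h1 := hfree i hi
    refine ⟨t i, by omega, ?_⟩
    ext k
    simp only [mem_filter, mem_univ, true_and]
    refine ⟨hmin k, fun hk => ?_⟩
    rcases hk.eq_or_lt with h | h
    · exact hblock i k h h0 hi
    · by_contra hkU
      exact absurd (hπ i k h) (not_lt.2 (hupper i hi k hkU).le)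

lemma GapFree.exists_eq {t : Fin n → ℕ} (ht : GapFree t) {i : Fin n} {v : ℕ} (hv : 2 ≤ v)
    (hvi : v ≤ t i) : ∃ k, t k = v := by
  induction hd : t i - v generalizing i with
  | zero => exact ⟨i, by omega⟩
  | succ d ih =>
    obtain ⟨k, hk⟩ := ht i (by omega)
    exact ih (i := k) (by omega) (by omega)

open Classical in
/-- A level `≥ 2` is recovered from the face by counting the tight sets around the coordinate. -/
lemma card_tight_sets {t : Fin n → ℕ} (hg : GapFree t) (ht : #{i | t i ≤ 1} ≠ 1) (i : Fin n) :
    #{U : Finset (Fin n) | (∀ x ∈ levelFace t, ∑ k ∈ U, x k = topSum n #U) ∧ i ∈ U} =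
      t i - 1 := by
  have hset : ({U : Finset (Fin n) | (∀ x ∈ levelFace t, ∑ k ∈ U, x k = topSum n #U) ∧ i ∈ U} :
      Finset _) = (Icc 2 (t i)).image fun θ => ({k | θ ≤ t k} : Finset (Fin n)) := by
    ext U
    simp only [mem_filter, mem_univ, true_and, tight_iff ht, mem_image, mem_Icc]
    constructor
    · rintro ⟨⟨θ, hθ, rfl⟩, hi⟩
      exact ⟨θ, ⟨hθ, by simpa using hi⟩, rfl⟩
    · rintro ⟨θ, ⟨hθ, hi⟩, rfl⟩
      exact ⟨⟨θ, hθ, rfl⟩, by simpa using hi⟩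
  have hlt : ∀ θ θ', 2 ≤ θ → θ' ≤ t i → θ < θ' →
      ({k | θ ≤ t k} : Finset (Fin n)) ≠ ({k | θ' ≤ t k} : Finset (Fin n)) := by
    intro θ θ' hθ hθ' h heq
    obtain ⟨k, rfl⟩ := hg.exists_eq hθ (h.le.trans hθ')
    have : k ∈ ({j | t k ≤ t j} : Finset (Fin n)) := by simp
    rw [heq] at this
    simp only [mem_filter, mem_univ, true_and] at this
    omega
  rw [hset, card_image_of_injOn, Nat.card_Icc]
  · omega
  · intro θ hθ θ' hθ' heq
    rw [mem_coe, mem_Icc] at hθ hθ'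
    rcases lt_trichotomy θ θ' with h | h | h
    · exact absurd heq (hlt θ θ' hθ.1 hθ'.2 h)
    · exact h
    · exact absurd heq.symm (hlt θ' θ hθ'.1 hθ.2 h)

lemma levelFace_injective {t u : Fin n → ℕ} (hgt : GapFree t) (ht : #{i | t i ≤ 1} ≠ 1)
    (hgu : GapFree u) (hu : #{i | u i ≤ 1} ≠ 1) (h : levelFace t = levelFace u) : t = u := by
  classical
  ext i
  have h1 : t i - 1 = u i - 1 := by
    rw [← card_tight_sets hgt ht i, ← card_tight_sets hgu hu i, h]
  -- levels `0` and `1` are told apart by whether the coordinate is constant on the face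
  have hfree : ∀ {w : Fin n → ℕ}, #{i | w i ≤ 1} ≠ 1 → w i = 1 → ¬ ∀ x ∈ levelFace w, x i = 1 := by
    intro w hw hwi hx
    have := apply_eq_zero_of_mem_vectorSpan (LinearMap.proj i) 1 hx _ (single_mem hw hwi)
    simp at this
  have h0 : t i = 0 → u i ≠ 1 := fun h0 hui => hfree hu hui (h ▸ fun x hx => hx.2.1 i h0)
  have h0' : u i = 0 → t i ≠ 1 := fun h0 hti => hfree ht hti (h ▸ fun x hx => hx.2.1 i h0)
  omega

/-! ### Counting gap-free level functions -/

lemma gapFree_and_card_iff (t : Fin n → ℕ) (r : ℕ) :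
    (GapFree t ∧ #{v ∈ univ.image t | 2 ≤ v} = r) ↔
      (univ.image t).erase 0 = Icc 1 (r + 1) ∨ (univ.image t).erase 0 = Icc 2 (r + 1) := by
  constructor
  · rintro ⟨hg, hr⟩
    have hV : ∃ M, ({v ∈ univ.image t | 2 ≤ v} : Finset ℕ) = Icc 2 M := by
      rcases ({v ∈ univ.image t | 2 ≤ v} : Finset ℕ).eq_empty_or_nonempty with h | h
      · exact ⟨0, by rw [h]; rfl⟩
      · obtain ⟨M, hM, hmax⟩ := exists_max_image _ id h
        refine ⟨M, ?_⟩
        ext v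
        rw [mem_Icc]
        constructor
        · intro hv
          exact ⟨(mem_filter.1 hv).2, hmax v hv⟩
        · rintro ⟨h2, hvM⟩
          obtain ⟨i, -, rfl⟩ := mem_image.1 (mem_filter.1 hM).1
          obtain ⟨k, rfl⟩ := hg.exists_eq h2 hvM
          simpa using h2
    obtain ⟨M, hM⟩ := hV
    rw [hM, Nat.card_Icc] at hr
    have hmem : ∀ v, (∃ i, t i = v) ∧ 2 ≤ v ↔ 2 ≤ v ∧ v ≤ M := fun v => by
      rw [← mem_Icc, ← hM]; simp
    by_cases h1 : ∃ i, t i = 1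
    · left
      ext v
      have := hmem v
      simp only [mem_erase, mem_image, mem_univ, true_and, mem_Icc]
      rcases eq_or_ne v 1 with rfl | hv
      · simp [h1]
      · constructor
        · rintro ⟨h0, h⟩
          have := this.1 ⟨h, by omega⟩
          omega
        · rintro ⟨h0, h⟩
          exact ⟨by omega, (this.2 ⟨by omega, by omega⟩).1⟩
    · right
      ext v
      have := hmem v
      simp only [mem_erase, mem_image, mem_univ, true_and, mem_Icc]
      rcases eq_or_ne v 1 with rfl | hv
      · simp [h1]
      · constructor
        · rintro ⟨h0, h⟩
          have := this.1 ⟨h, by omega⟩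
          omega
        · rintro ⟨h0, h⟩
          exact ⟨by omega, (this.2 ⟨by omega, by omega⟩).1⟩
  · intro h
    have hmem : ∀ v, 2 ≤ v → ((∃ i, t i = v) ↔ v ≤ r + 1) := by
      intro v hv
      have hv' : v ∈ (univ.image t).erase 0 ↔ ∃ i, t i = v := by
        simp only [mem_erase, mem_image, mem_univ, true_and, and_iff_right_iff_imp]
        omega
      rw [← hv']
      rcases h with h | h <;> rw [h, mem_Icc] <;> omega
    refine ⟨fun i hi => ?_, ?_⟩
    · have h1 := (hmem (t i) (by omega)).1 ⟨i, rfl⟩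
      obtain ⟨k, hk⟩ := (hmem (t i - 1) (by omega)).2 (by omega)
      exact ⟨k, by omega⟩
    · have : ({v ∈ univ.image t | 2 ≤ v} : Finset ℕ) = Icc 2 (r + 1) := by
        ext v
        simp only [mem_filter, mem_image, mem_univ, true_and, mem_Icc]
        constructor
        · rintro ⟨h1, h2⟩
          exact ⟨h2, (hmem v h2).1 h1⟩
        · rintro ⟨h1, h2⟩
          exact ⟨(hmem v h1).2 h2, h1⟩
      rw [this, Nat.card_Icc]
      omega

/-- Gap-free level functions with `m` zeros and `r` levels `≥ 2` amount to a choice of the zeros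
and an ordering of all but one block of a partition of the remaining positions and one extra point
into `r + 1` blocks; the block of the extra point collects the positions of level `1`. -/
lemma ncard_gapFree (n m r : ℕ) :
    {t : Fin n → ℕ | #{i | t i = 0} = m ∧ GapFree t ∧ #{v ∈ univ.image t | 2 ≤ v} = r}.Finite ∧
    {t : Fin n → ℕ | #{i | t i = 0} = m ∧ GapFree t ∧ #{v ∈ univ.image t | 2 ≤ v} = r}.ncard =
      n.choose m * r.factorial * Nat.stirlingSecond (n - m + 1) (r + 1) := by
  have h1 := ncard_levels n m (Icc 1 (r + 1)) (by simp)
  have h2 := ncard_levels n m (Icc 2 (r + 1)) (by simp)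
  have hset : {t : Fin n → ℕ | #{i | t i = 0} = m ∧ GapFree t ∧
      #{v ∈ univ.image t | 2 ≤ v} = r} =
      {t : Fin n → ℕ | #{i | t i = 0} = m ∧ (univ.image t).erase 0 = Icc 1 (r + 1)} ∪
      {t : Fin n → ℕ | #{i | t i = 0} = m ∧ (univ.image t).erase 0 = Icc 2 (r + 1)} := by
    ext t
    simp only [Set.mem_union, Set.mem_ofPred_eq, gapFree_and_card_iff, and_or_left]
  rw [hset]
  refine ⟨h1.1.union h2.1, ?_⟩
  rw [Set.ncard_union_eq _ h1.1 h2.1, h1.2, h2.2]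
  · simp only [Nat.card_Icc, Nat.add_sub_cancel, Nat.stirlingSecond_succ_succ,
      show r + 1 + 1 - 2 = r by omega, Nat.factorial_succ]
    ring
  · rw [Set.disjoint_left]
    rintro t ⟨-, ht1⟩ ⟨-, ht2⟩
    rw [ht1] at ht2
    have : 1 ∈ Icc 2 (r + 1) := by rw [← ht2]; simp
    simp at this

lemma ncard_gapFree_codim (n s : ℕ) :
    {t : Fin n → ℕ | GapFree t ∧ #{i | t i = 0} ≠ 1 ∧ levelCodim t = s}.Finite ∧
    {t : Fin n → ℕ | GapFree t ∧ #{i | t i = 0} ≠ 1 ∧ levelCodim t = s}.ncard =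
      ∑ m ∈ (range (s + 1)).filter (fun m => m ≠ 1),
        n.choose m * (s - m).factorial * Nat.stirlingSecond (n - m + 1) (s - m + 1) := by
  classical
  set A := {t : Fin n → ℕ | GapFree t ∧ #{i | t i = 0} ≠ 1 ∧ levelCodim t = s} with hA
  have hfin : A.Finite := by
    refine ((finite_toSet (range (s + 1))).biUnion
      fun m _ => (ncard_gapFree n m (s - m)).1).subset ?_
    rintro t ⟨hg, -, hs⟩
    rw [levelCodim] at hs
    simp only [Set.mem_iUnion, mem_coe, mem_range]
    exact ⟨#{i | t i = 0}, by omega, rfl, hg, by omega⟩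
  refine ⟨hfin, ?_⟩
  rw [Set.ncard_eq_toFinset_card A hfin, card_eq_sum_card_fiberwise
    (f := fun t : Fin n → ℕ => #{i | t i = 0}) (t := (range (s + 1)).filter (fun m => m ≠ 1))]
  · refine sum_congr rfl fun m hm => ?_
    rw [mem_filter, mem_range] at hm
    rw [← (ncard_gapFree n m (s - m)).2, ← Set.ncard_coe_finset]
    congr 1
    ext t
    simp only [coe_filter, Set.Finite.mem_toFinset, hA, Set.mem_ofPred_eq, levelCodim]
    constructor
    · rintro ⟨⟨hg, h1, hs⟩, h⟩
      exact ⟨h, hg, by omega⟩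
    · rintro ⟨h, hg, hr⟩
      exact ⟨⟨hg, by omega, by omega⟩, h⟩
  · intro t ht
    rw [Set.Finite.coe_toFinset] at ht
    have hs := ht.2.2
    rw [levelCodim] at hs
    simp only [coe_filter, mem_range, Set.mem_ofPred_eq]
    exact ⟨by omega, ht.2.1⟩

lemma levelCodim_add_one {u : Fin n → ℕ} (h0 : #{i | u i = 0} = 1) (h1 : ∃ i, u i = 1) :
    levelCodim (fun i => u i + 1) = levelCodim u := by
  have hz : #{i | u i + 1 = 0} = 0 := by simp
  have hset : ({v ∈ univ.image (fun i => u i + 1) | 2 ≤ v} : Finset ℕ) =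
      (insert 1 {v ∈ univ.image u | 2 ≤ v}).image (· + 1) := by
    ext v
    simp only [mem_filter, mem_image, mem_univ, true_and, mem_insert]
    constructor
    · rintro ⟨⟨i, rfl⟩, hv⟩
      refine ⟨u i, ?_, rfl⟩
      rcases eq_or_ne (u i) 1 with h | h
      · exact Or.inl h
      · exact Or.inr ⟨⟨i, rfl⟩, by omega⟩
    · rintro ⟨w, rfl | ⟨⟨i, rfl⟩, hw⟩, rfl⟩
      · obtain ⟨i, hi⟩ := h1
        exact ⟨⟨i, by rw [hi]⟩, le_rfl⟩
      · exact ⟨⟨i, rfl⟩, by omega⟩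
  rw [levelCodim, levelCodim, hz, h0, hset, card_image_of_injective _ (add_left_injective 1),
    card_insert_of_notMem (by simp)]
  omega

/-- Two ways of excluding degenerate level functions give the same count: when there is exactly
one zero, raising all levels by one turns it into the only coordinate of level `1`, and the former
coordinates of level `1` into the lowest block. -/
lemma ncard_nondegenerate (n s : ℕ) (hns : ¬ (n = 1 ∧ s = 0)) :
    {t : Fin n → ℕ | GapFree t ∧ #{i | t i ≤ 1} ≠ 1 ∧ levelCodim t = s}.Finite ∧
    {t : Fin n → ℕ | GapFree t ∧ #{i | t i ≤ 1} ≠ 1 ∧ levelCodim t = s}.ncard =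
    {t : Fin n → ℕ | GapFree t ∧ #{i | t i = 0} ≠ 1 ∧ levelCodim t = s}.ncard := by
  set N := {t : Fin n → ℕ | GapFree t ∧ #{i | t i ≤ 1} ≠ 1 ∧ levelCodim t = s}
  set A := {t : Fin n → ℕ | GapFree t ∧ #{i | t i = 0} ≠ 1 ∧ levelCodim t = s}
  let g : (Fin n → ℕ) → (Fin n → ℕ) := fun u =>
    if #{i | u i = 0} = 1 then fun i => u i + 1 else u
  have hone : ∀ u : Fin n → ℕ, #{i | u i = 0} = 1 → #{i | u i ≤ 1} ≠ 1 → ∃ i, u i = 1 := by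
    intro u h0 h1
    by_contra! hne
    apply h1
    rw [← h0]
    congr 1
    ext i
    have := hne i
    simp only [mem_filter, mem_univ, true_and]
    omega
  have hinj : Set.InjOn g N := by
    have hmixed : ∀ u u' : Fin n → ℕ, #{i | u i = 0} = 1 → #{i | u' i ≤ 1} ≠ 1 →
        (fun i => u i + 1) ≠ u' := by
      rintro u u' h0 h1 rfl
      apply h1
      rw [← h0]
      congr 1
      ext i
      simp
    intro u hu u' hu' heq
    simp only [g] at heq
    split_ifs at heq with h h' h'
    · ext i
      simpa using congrFun heq i
    · exact absurd heq (hmixed u u' h hu'.2.1)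
    · exact absurd heq.symm (hmixed u' u h' hu.2.1)
    · exact heq
  have himg : g '' N = A := by
    ext t
    constructor
    · rintro ⟨u, ⟨hg, h1, hs⟩, rfl⟩
      simp only [g]
      split_ifs with h
      · obtain ⟨k, hk⟩ := hone u h h1
        refine ⟨fun i hi => ?_, by simp, (levelCodim_add_one h ⟨k, hk⟩).trans hs⟩
        rcases Nat.lt_or_ge (u i) 3 with h3 | h3
        · exact ⟨k, by simp only at hi ⊢; omega⟩
        · obtain ⟨l, hl⟩ := hg i h3
          exact ⟨l, by simp only; omega⟩
      · exact ⟨hg, h, hs⟩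
    · rintro ⟨hg, h0, hs⟩
      by_cases h : #{i | t i ≤ 1} = 1
      swap
      · exact ⟨t, ⟨hg, h, hs⟩, if_neg h0⟩
      have hz : ∀ i, t i ≠ 0 := by
        have hle : #{i | t i = 0} ≤ #{i | t i ≤ 1} :=
          card_le_card fun i hi => by
            simp only [mem_filter, mem_univ, true_and] at hi ⊢
            omega
        have : #{i | t i = 0} = 0 := by omega
        rw [card_eq_zero, filter_eq_empty_iff] at this
        exact fun i => this (mem_univ i)
      obtain ⟨i₀, hi₀⟩ := card_eq_one.1 h
      have hiff : ∀ i, t i ≤ 1 ↔ i = i₀ := fun i => by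
        rw [← mem_singleton, ← hi₀]; simp
      -- level `2` is attained, as otherwise `n = 1` and the codimension vanishes
      have htwo : ∃ k, t k = 2 := by
        by_contra! hno
        have hall : ∀ i, i = i₀ := by
          intro i
          rw [← hiff]
          by_contra hi
          obtain ⟨k, hk⟩ := hg.exists_eq (i := i) le_rfl (by omega)
          exact hno k hk
        have hn : n = 1 := by
          have : Fintype.card (Fin n) = 1 := Fintype.card_eq_one_iff.2 ⟨i₀, hall⟩
          simpa using this
        refine hns ⟨hn, ?_⟩
        rw [← hs, levelCodim]
        have e1 : #{i | t i = 0} = 0 := by simp [hz]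
        have e2 : #{v ∈ univ.image t | 2 ≤ v} = 0 := by
          rw [card_eq_zero, filter_eq_empty_iff]
          intro v hv
          obtain ⟨i, -, rfl⟩ := mem_image.1 hv
          have := (hiff i).2 (hall i)
          omega
        omega
      obtain ⟨k, hk⟩ := htwo
      let u : Fin n → ℕ := fun i => t i - 1
      have hut : (fun i => u i + 1) = t := by
        ext i
        have := hz i
        simp only [u]
        omega
      have hu0 : #{i | u i = 0} = 1 := by
        rw [← h]
        congr 1
        ext i
        have := hz i
        simp only [u, mem_filter, mem_univ, true_and]
        omega
      have huk : u k = 1 := by simp [u, hk]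
      refine ⟨u, ⟨fun i hi => ?_, ?_, ?_⟩, ?_⟩
      · simp only [u] at hi ⊢
        obtain ⟨l, hl⟩ := hg i (by omega)
        exact ⟨l, by omega⟩
      · have hlt : #{i | u i = 0} < #{i | u i ≤ 1} := by
          refine card_lt_card ⟨fun i hi => ?_, fun hsub => ?_⟩
          · simp only [mem_filter, mem_univ, true_and] at hi ⊢
            omega
          · have := @hsub k (by simp [huk])
            simp [huk] at this
        omega
      · rw [← hs, ← hut, levelCodim_add_one hu0 ⟨k, huk⟩]
      · simp only [g, if_pos hu0]
        exact hut
  refine ⟨Set.Finite.of_finite_image ?_ hinj, ?_⟩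
  · rw [himg]
    exact (ncard_gapFree_codim n s).1
  · rw [← himg, hinj.ncard_image]

lemma facesOfDim_eq_image {n s : ℕ} (hs : s ≤ n) :
    facesOfDim (parkingPolytope n) (n - s) =
      levelFace '' {t : Fin n → ℕ | GapFree t ∧ #{i | t i ≤ 1} ≠ 1 ∧ levelCodim t = s} := by
  ext F
  constructor
  · rintro ⟨hF, hne, hdim⟩
    obtain ⟨c, rfl⟩ := isFace_nonempty_iff.1 ⟨hF, hne⟩
    obtain ⟨t, ht, hct⟩ := exists_gapFree_tightFace_eq c
    obtain ⟨u, hu, hu1, htu⟩ := exists_nondegenerate t ht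
    rw [hct, htu] at hdim ⊢
    have := finrank_levelFace hu1
    exact ⟨u, ⟨hu, hu1, by omega⟩, rfl⟩
  · rintro ⟨t, ⟨hg, h1, hc⟩, rfl⟩
    have hdim := finrank_levelFace h1
    have hface := isFace_nonempty_iff.2 ⟨_, levelFace_eq_tightFace t⟩
    exact ⟨hface.1, hface.2, by omega⟩

end ParkingPolytope

theorem theorem3p1 (n s : ℕ) (hs : s ≤ n) (hns : ¬ (n = 1 ∧ s = 0)) :
    (ParkingPolytope.facesOfDim (ParkingPolytope.parkingPolytope n) (n - s)).Finite ∧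
    (ParkingPolytope.facesOfDim (ParkingPolytope.parkingPolytope n) (n - s)).ncard =
      ∑ m ∈ (Finset.range (s + 1)).filter (fun m => m ≠ 1),
        n.choose m * (s - m).factorial * Nat.stirlingSecond (n - m + 1) (s - m + 1) := by
  have hcount := ParkingPolytope.ncard_nondegenerate n s hns
  rw [ParkingPolytope.facesOfDim_eq_image hs]
  refine ⟨hcount.1.image _, ?_⟩
  rw [Set.InjOn.ncard_image, hcount.2, (ParkingPolytope.ncard_gapFree_codim n s).2]
  intro t ht u hu h
  exact ParkingPolytope.levelFace_injective ht.1 ht.2.1 hu.1 hu.2.1 h
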